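/- Let $d\ge 0$, $p=d+1$, and write $\xi=(X,Y)\in\mathbb R^d\times\mathbb R=\mathbb R^p$. For $k\in\{\mathrm S,\mathrm T\}$ (source, target) let $(\hat x^k_i,\hat y^k_i)_{i=1}^{N_k}$ be samples in $\mathbb R^d\times\mathbb R$, put $\hat\xi^k_i=(\hat x^k_i,\hat y^k_i)\in\mathbb R^p$, let $$\hat\mu_k=\frac1{N_k}\sum_{i=1}^{N_k}\hat\xi^k_i,\qquad \hat\Sigma_k=\frac1{N_k}\sum_{i=1}^{N_k}\hat\xi^k_i(\hat\xi^k_i)^\top-\hat\mu_k\hat\mu_k^\top$$ be their empirical mean vector and covariance matrix, and assume $\hat\Sigma_k\succ0$. For $\mu\in\mathbb R^p$ and $\Sigma\succ 0$ let $$D\big((\mu,\Sigma)\,\|\,(\hat\mu_k,\hat\Sigma_k)\big)=(\hat\mu_k-\mu)^\top\hat\Sigma_k^{-1}(\hat\mu_k-\mu)+\operatorname{Tr}(\Sigma\hat\Sigma_k^{-1})-\log\det(\Sigma\hat\Sigma_k^{-1})-p$$ be the KL-type divergence. Given $\rho_{\mathrm S},\rho_{\mathrm T}\in\mathbb R$ and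 $\varepsilon>0$, let $\mathbb U$ be the set of all $(\mu,\Sigma)$ with $\mu\in\mathbb R^p$, $\Sigma\succ0$, $D((\mu,\Sigma)\|(\hat\mu_k,\hat\Sigma_k))\le\rho_k$ for $k\in\{\mathrm S,\mathrm T\}$, and $\Sigma+\mu\mu^\top\succeq\varepsilon I_p$. Let $\mathbb B$ be the set of all probability distributions on $\mathbb R^p$ with finite second moments whose mean vector $\mu$ and covariance matrix $\Sigma$ satisfy $(\mu,\Sigma)\in\mathbb U$. **Theorem (SI-KL expert).** Suppose that $\mathbb B$ is non-empty. Consider the program $$\begin{array}{cl}\sup&\tau\\ \text{s.t.}&M=\begin{bmatrix}M_{XX}&M_{XY}\\M_{XY}^\top&M_{YY}\end{bmatrix}\succ 0,\quad M_{XX}\in\mathbb R^{d\times d},\ M_{XY}\in\mathbb R^{d\times1},\ M_{YY}\in\mathbb R,\\[1ex] &\mu\in\mathbb R^p,\quad \tau\ge0,\quad 0\le t<1,\\[0.5ex] &\hat\mu_k^\top\hat\Sigma_k^{-1}\hat\mu_k-2\hat\mu_k^\top\hat\Sigma_k^{-1}\mu+\operatorname{Tr}(M\hat\Sigma_k^{-1})-\log\det(M\hat\Sigma_k^{-1})-\log(1-t)-p\le\rho_k\quad\forall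 k\in\{\mathrm S,\mathrm T\},\\[0.5ex] &\begin{bmatrix}M&\mu\\\mu^\top&t\end{bmatrix}\succeq0,\quad\begin{bmatrix}M_{XX}&M_{XY}\\M_{XY}^\top&M_{YY}-\tau\end{bmatrix}\succeq0,\quad M\succeq\varepsilon I_p\end{array}$$ in the variables $(M,\mu,t,\tau)$. This program is convex (its feasible set is convex and its objective is linear) and has an optimal solution. For every optimal solution $(M^\star,\mu^\star,t^\star,\tau^\star)$ the matrix $M^\star_{XX}$ is invertible, and $\beta^\star=(M^\star_{XX})^{-1}M^\star_{XY}$ solves the distributionally robust least-squares problem $$\inf_{\beta\in\mathbb R^d}\ \sup_{Q\in\mathbb B}\ \mathbb E_Q\big[(\beta^\top X-Y)^2\big],$$ that is, $\beta^\star$ attains the infimum, and the optimal value is finite. -/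

import Mathlib

open Matrix MeasureTheory ProbabilityTheory

noncomputable section

namespace SIKL

/-- Index set of the `p = d + 1` coordinates of `ξ = (X, Y)`: `Sum.inl i` is the `i`-th
coordinate of the covariate `X`, and `Sum.inr ()` is the response `Y`. -/
abbrev Idx (d : ℕ) : Type := Fin d ⊕ Unit

/-- The space `ℝᵖ` in which `ξ = (X, Y)` takes its values. -/
abbrev Vec (d : ℕ) : Type := Idx d → ℝ

/-- Real `p × p` matrices. -/
abbrev Mat (d : ℕ) : Type := Matrix (Idx d) (Idx d) ℝ

/-- The joint vector `(x, y)`. -/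
def joint {d : ℕ} (x : Fin d → ℝ) (y : ℝ) : Vec d := Sum.elim x (fun _ => y)

/-- Empirical mean vector of the labelled samples `(x i, y i)`. -/
def empMean {d N : ℕ} (x : Fin N → Fin d → ℝ) (y : Fin N → ℝ) : Vec d :=
  (N : ℝ)⁻¹ • ∑ i, joint (x i) (y i)

/-- Empirical covariance matrix of the labelled samples `(x i, y i)`. -/
def empCov {d N : ℕ} (x : Fin N → Fin d → ℝ) (y : Fin N → ℝ) : Mat d :=
  (N : ℝ)⁻¹ • ∑ i, vecMulVec (joint (x i) (y i)) (joint (x i) (y i))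
    - vecMulVec (empMean x y) (empMean x y)

/-- The KL-type divergence `D((μ, Σ) ‖ (μ', Σ'))`, a divergence between pairs with
positive definite covariance matrices:
`(μ' - μ)ᵀ Σ'⁻¹ (μ' - μ) + Tr(Σ Σ'⁻¹) - log det (Σ Σ'⁻¹) - p`. -/
def klDivergence {d : ℕ} (μ : Vec d) (S : Mat d) (μ' : Vec d) (S' : Mat d) : ℝ :=
  (μ' - μ) ⬝ᵥ (S'⁻¹ *ᵥ (μ' - μ)) + (S * S'⁻¹).trace - Real.log (S * S'⁻¹).det
    - ((d : ℝ) + 1)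

/-- The "surround, then intersect" moment set for the KL-type divergence: the pairs `(μ, Σ)`
within divergence `ρS` of `(μS, CS)` and `ρT` of `(μT, CT)` with `Σ + μ μᵀ ⪰ ε I`.
The divergence is only defined (finite) at positive definite `Σ`. -/
def momentSet {d : ℕ} (μS : Vec d) (CS : Mat d) (μT : Vec d) (CT : Mat d)
    (ρS ρT ε : ℝ) : Set (Vec d × Mat d) :=
  {q | q.2.PosDef ∧
    klDivergence q.1 q.2 μS CS ≤ ρS ∧
    klDivergence q.1 q.2 μT CT ≤ ρT ∧
    (q.2 + vecMulVec q.1 q.1 - ε • (1 : Mat d)).PosSemidef}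

/-- `Q ∼ (μ, Σ)`: the coordinates are square-integrable under `Q`, which has mean vector `μ` and
covariance matrix `Σ`. -/
def HasMoments {d : ℕ} (Q : Measure (Vec d)) (μ : Vec d) (S : Mat d) : Prop :=
  (∀ i, MemLp (fun ξ : Vec d => ξ i) 2 Q) ∧
  (∀ i, ∫ ξ, ξ i ∂Q = μ i) ∧
  (∀ i j, cov[fun ξ : Vec d => ξ i, fun ξ : Vec d => ξ j; Q] = S i j)

/-- The lifted distribution set: all probability distributions on `ℝᵖ` whose mean and covariance
matrix belong to the moment set `U`. -/
def distributionSet {d : ℕ} (U : Set (Vec d × Mat d)) : Set (Measure (Vec d)) :=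
  {Q | IsProbabilityMeasure Q ∧ ∃ q ∈ U, HasMoments Q q.1 q.2}

/-- The square loss `(βᵀ X - Y)²` at `ξ = (X, Y)`. -/
def loss {d : ℕ} (β : Fin d → ℝ) (ξ : Vec d) : ℝ :=
  (β ⬝ᵥ (fun i => ξ (Sum.inl i)) - ξ (Sum.inr ())) ^ 2

/-- The worst-case expected loss `sup_{Q ∈ B} E_Q[(βᵀ X - Y)²]`, in `[0, ∞]`. -/
def worstCaseRisk {d : ℕ} (B : Set (Measure (Vec d))) (β : Fin d → ℝ) : ENNReal :=
  ⨆ Q ∈ B, ∫⁻ ξ, ENNReal.ofReal (loss β ξ) ∂Q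

/-- `β` solves `inf_β sup_{Q ∈ B} E_Q[(βᵀ X - Y)²]`: its worst-case risk is finite and minimal. -/
def SolvesDRO {d : ℕ} (B : Set (Measure (Vec d))) (β : Fin d → ℝ) : Prop :=
  worstCaseRisk B β ≠ ⊤ ∧ ∀ β' : Fin d → ℝ, worstCaseRisk B β ≤ worstCaseRisk B β'

/-- The log-determinant constraint attached to the nominal moments `(m, C)` and the radius `ρ`:
`mᵀ C⁻¹ m - 2 mᵀ C⁻¹ μ + Tr(M C⁻¹) - log det (M C⁻¹) - log (1 - t) - p ≤ ρ`. -/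
def logDetConstraint {d : ℕ} (m : Vec d) (C : Mat d) (ρ : ℝ) (M : Mat d) (μ : Vec d) (t : ℝ) :
    Prop :=
  m ⬝ᵥ (C⁻¹ *ᵥ m) - 2 * (m ⬝ᵥ (C⁻¹ *ᵥ μ)) + (M * C⁻¹).trace - Real.log (M * C⁻¹).det
    - Real.log (1 - t) - ((d : ℝ) + 1) ≤ ρ

/-- The decision variables `(M, μ, t, τ)` of the semidefinite program. The blocks of `M` are
`M_XX = M.toBlocks₁₁`, `M_XY = M.toBlocks₁₂` and `M_YY = M.toBlocks₂₂`. -/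
abbrev SDPVar (d : ℕ) : Type := Mat d × Vec d × ℝ × ℝ

/-- Feasible set of the semidefinite program. The condition `t < 1` is the domain of
`log (1 - t)`. -/
def sdpFeasible {d : ℕ} (μS : Vec d) (CS : Mat d) (μT : Vec d) (CT : Mat d)
    (ρS ρT ε : ℝ) : Set (SDPVar d) :=
  {z | match z with
    | (M, μ, t, τ) =>
      0 ≤ τ ∧ M.PosDef ∧ 0 ≤ t ∧ t < 1 ∧
      logDetConstraint μS CS ρS M μ t ∧
      logDetConstraint μT CT ρT M μ t ∧
      (fromBlocks M (replicateCol Unit μ) (replicateRow Unit μ)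
        (of fun _ _ : Unit => t)).PosSemidef ∧
      (fromBlocks M.toBlocks₁₁ M.toBlocks₁₂ M.toBlocks₁₂ᵀ
        (M.toBlocks₂₂ - of fun _ _ : Unit => τ)).PosSemidef ∧
      (M - ε • (1 : Mat d)).PosSemidef}

/-- `z = (M, μ, t, τ)` solves the program of maximising `τ` over the feasible set `F`. -/
def SolvesSDP {d : ℕ} (F : Set (SDPVar d)) (z : SDPVar d) : Prop :=
  z ∈ F ∧ ∀ z' ∈ F, z'.2.2.2 ≤ z.2.2.2

/-- `(M_XX)⁻¹ M_XY`. -/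
def expert {d : ℕ} (M : Mat d) : Fin d → ℝ :=
  M.toBlocks₁₁⁻¹ *ᵥ (fun i => M.toBlocks₁₂ i ())

end SIKL

end

/-!
Write `M = S + μ μᵀ` for the second-moment matrix of a pair `(μ, S)`. Since
`det S = det M * (1 - μᵀ M⁻¹ μ)`, the divergence bounds become the log-determinant constraints at
`t = μᵀ M⁻¹ μ` (`klDivergence_eq`). The block constraint `[M μ; μᵀ t] ⪰ 0` says `t ≥ μᵀ M⁻¹ μ`, and
a larger `t` only tightens the constraints, so the pairs `(M, μ)` occurring in the program are
exactly those coming from the moment set (`sdpFeasible_of_mem_momentSet`,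
`mem_momentSet_of_sdpFeasible`). Similarly, the block constraint on `τ` says that `τ` is at most
`min_β quadRisk M β`, the Schur complement of `M_XX`, attained at `expert M`
(`expertBlock_posSemidef_iff`). The program is therefore the max-min problem dual to the robust
least-squares problem.

Convexity of the feasible set is concavity of `log det`, which follows from
`log det (A B) ≤ Tr (A B) - n` (`log_det_concave`). The same inequality bounds `Tr (M C⁻¹)` on the
feasible set, which is also closed once the logarithms are exponentiated
(`isCompact_sdpFeasible`); an optimal solution exists by compactness.

If `(M, μ, t, τ)` is optimal, then `expert M` and `M` form a saddle point: moving from `M` towards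
another feasible `M'` and letting the step tend to zero yields `quadRisk M' (expert M) ≤ τ`
(`quadRisk_le_of_solvesSDP`). So the worst-case risk of `expert M` is at most `τ`, whereas the
Gaussian distribution with the moments encoded by `(M, μ)` forces every `β` to have worst-case risk
at least `quadRisk M β ≥ τ`.
-/

namespace SIKL

/-! ### Positive semidefinite matrices -/

section Matrices

variable {n : Type*}

theorem posDef_convexCombo {A B : Matrix n n ℝ} (hA : A.PosDef) (hB : B.PosDef) {a b : ℝ}
    (ha : 0 ≤ a) (hb : 0 ≤ b) (hab : a + b = 1) : (a • A + b • B).PosDef := by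
  rcases ha.eq_or_lt with rfl | ha
  · obtain rfl : b = 1 := by linarith
    simpa using hB
  · exact (hA.smul ha).add_posSemidef (hB.posSemidef.smul hb)

theorem posSemidef_convexCombo {A B : Matrix n n ℝ} (hA : A.PosSemidef) (hB : B.PosSemidef)
    {a b : ℝ} (ha : 0 ≤ a) (hb : 0 ≤ b) : (a • A + b • B).PosSemidef :=
  (hA.smul ha).add (hB.smul hb)

theorem sq_entry_le {A : Matrix n n ℝ} (hA : A.PosSemidef) (i j : n) :
    A i j ^ 2 ≤ A i i * A j j := by
  have h := (hA.submatrix ![i, j]).det_nonneg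
  have hs : A j i = A i j := by simpa using hA.1.apply i j
  rw [det_fin_two] at h
  simp [hs] at h
  linarith

variable [Fintype n]

theorem isClosed_posSemidef : IsClosed {A : Matrix n n ℝ | A.PosSemidef} := by
  simp only [posSemidef_iff_dotProduct_mulVec, Set.ofPred_and, Set.ofPred_forall]
  refine IsClosed.inter (isClosed_eq (by fun_prop) (by fun_prop)) (isClosed_iInter fun x => ?_)
  exact isClosed_le (by fun_prop) (by fun_prop)

theorem dotProduct_vecMulVec_mulVec (μ x : n → ℝ) :
    x ⬝ᵥ (vecMulVec μ μ *ᵥ x) = (μ ⬝ᵥ x) ^ 2 := by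
  rw [vecMulVec_mulVec, dotProduct_smul, dotProduct_comm x μ]
  simp [sq]

theorem posSemidef_vecMulVec (μ : n → ℝ) : (vecMulVec μ μ).PosSemidef := by
  simpa using posSemidef_vecMulVec_self_star μ

/-- The quadratic form of the moment matrix `[M μ; μᵀ t]`. -/
theorem bordered_quadForm (M : Matrix n n ℝ) (μ : n → ℝ) (t : ℝ) (x : n → ℝ) (s : ℝ) :
    Sum.elim x (fun _ : Unit => s) ⬝ᵥ (fromBlocks M (replicateCol Unit μ) (replicateRow Unit μ)
      (of fun _ _ : Unit => t) *ᵥ Sum.elim x (fun _ : Unit => s))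
      = x ⬝ᵥ (M *ᵥ x) + 2 * s * (μ ⬝ᵥ x) + s ^ 2 * t := by
  rw [fromBlocks_mulVec]
  have h1 : replicateCol Unit μ *ᵥ (fun _ : Unit => s) = s • μ := by
    ext i; simp [mulVec, dotProduct, mul_comm]
  simp only [sumElim_dotProduct_sumElim, Sum.elim_comp_inl, Sum.elim_comp_inr, h1, dotProduct_add,
    dotProduct_smul]
  simp [mulVec, dotProduct, mul_comm]
  ring_nf

/-- Evaluate the quadratic form of the bordered matrix at `(x, -μᵀ x)`; strictness comes from
`t < 1` if `μᵀ x ≠ 0` and from `M` otherwise. -/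
theorem posDef_sub_vecMulVec {M : Matrix n n ℝ} (hM : M.PosDef) {μ : n → ℝ} {t : ℝ} (ht : t < 1)
    (h : (fromBlocks M (replicateCol Unit μ) (replicateRow Unit μ)
      (of fun _ _ : Unit => t)).PosSemidef) : (M - vecMulVec μ μ).PosDef := by
  refine PosDef.of_dotProduct_mulVec_pos (hM.1.sub (posSemidef_vecMulVec μ).1) fun x hx => ?_
  have h1 := h.dotProduct_mulVec_nonneg (Sum.elim x fun _ => -(μ ⬝ᵥ x))
  have h2 := hM.dotProduct_mulVec_pos hx
  rw [star_trivial] at h1 h2 ⊢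
  rw [bordered_quadForm] at h1
  rw [sub_mulVec, dotProduct_sub, dotProduct_vecMulVec_mulVec]
  by_cases h0 : μ ⬝ᵥ x = 0
  · rw [h0]; linarith
  · nlinarith [mul_pos (sub_pos.mpr ht) (pow_pos (abs_pos.mpr h0) 2), sq_abs (μ ⬝ᵥ x)]

theorem symm_dotProduct {A : Matrix n n ℝ} (hA : A.IsHermitian)
    (x y : n → ℝ) : x ⬝ᵥ (A *ᵥ y) = y ⬝ᵥ (A *ᵥ x) := by
  rw [dotProduct_mulVec, dotProduct_comm, ← mulVec_transpose]
  rw [← conjTranspose_eq_transpose_of_trivial, hA.eq]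

theorem trace_vecMulVec_mul (μ : n → ℝ) (A : Matrix n n ℝ) :
    (vecMulVec μ μ * A).trace = μ ⬝ᵥ (A *ᵥ μ) := by
  rw [vecMulVec_mul, trace_vecMulVec, dotProduct_comm, dotProduct_mulVec, dotProduct_comm]

variable [DecidableEq n]

open scoped MatrixOrder in
theorem exists_eq_conjTranspose_mul_self {B : Matrix n n ℝ} (hB : B.PosSemidef) :
    ∃ P : Matrix n n ℝ, B = Pᴴ * P := by
  obtain ⟨P, hP⟩ := CStarAlgebra.nonneg_iff_eq_star_mul_self.mp hB.nonneg
  exact ⟨P, hP⟩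

theorem trace_mul_nonneg {A B : Matrix n n ℝ} (hA : A.PosSemidef) (hB : B.PosSemidef) :
    0 ≤ (A * B).trace := by
  obtain ⟨P, rfl⟩ := exists_eq_conjTranspose_mul_self hB
  rw [← Matrix.mul_assoc, trace_mul_comm, ← Matrix.mul_assoc]
  exact (hA.mul_mul_conjTranspose_same P).trace_nonneg

theorem det_mul_pos {A B : Matrix n n ℝ} (hA : A.PosDef) (hB : B.PosDef) :
    0 < (A * B).det := by
  rw [det_mul]; exact mul_pos hA.det_pos hB.det_pos

/-- The product `A * B` is similar to a positive definite matrix, so this is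
`log x ≤ x - 1` summed over its eigenvalues. -/
theorem log_det_mul_le {A B : Matrix n n ℝ} (hA : A.PosDef) (hB : B.PosDef) :
    Real.log (A * B).det ≤ (A * B).trace - Fintype.card n := by
  have hdet := det_mul_pos hA hB
  obtain ⟨P, rfl⟩ := exists_eq_conjTranspose_mul_self hB.posSemidef
  have htr : (A * (Pᴴ * P)).trace = (P * A * Pᴴ).trace := by
    rw [← Matrix.mul_assoc, trace_mul_comm, ← Matrix.mul_assoc]
  have hd : (A * (Pᴴ * P)).det = (P * A * Pᴴ).det := by
    simp only [det_mul]; ring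
  rw [hd] at hdet
  rw [htr, hd]
  have hX : (P * A * Pᴴ).PosDef :=
    (hA.posSemidef.mul_mul_conjTranspose_same P).posDef_iff_det_ne_zero.mpr hdet.ne'
  have h1 := hX.1.det_eq_prod_eigenvalues
  have h2 := hX.1.trace_eq_sum_eigenvalues
  simp only [RCLike.ofReal_real_eq_id, id] at h1 h2
  rw [h1, h2, Real.log_prod fun i _ => (hX.eigenvalues_pos i).ne']
  have : ∑ i, Real.log (hX.1.eigenvalues i) ≤ ∑ i, (hX.1.eigenvalues i - 1) :=
    Finset.sum_le_sum fun i _ => Real.log_le_sub_one_of_pos (hX.eigenvalues_pos i)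
  simpa using this

/-- Concavity of `log det`: each of `A` and `B` satisfies the tangent inequality
`log det A ≤ log det T + Tr (A T⁻¹) - n` at the point `T = a A + b B`, and the convex
combination of the right-hand sides is `log det T`. -/
theorem log_det_concave {A B : Matrix n n ℝ} (hA : A.PosDef) (hB : B.PosDef) {a b : ℝ}
    (ha : 0 ≤ a) (hb : 0 ≤ b) (hab : a + b = 1) :
    a * Real.log A.det + b * Real.log B.det ≤ Real.log (a • A + b • B).det := by
  set T := a • A + b • B with hT
  have hTp : T.PosDef := posDef_convexCombo hA hB ha hb hab
  have key : ∀ X : Matrix n n ℝ, X.PosDef →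
      Real.log X.det - Real.log T.det ≤ (X * T⁻¹).trace - Fintype.card n := by
    intro X hX
    have h := log_det_mul_le hX hTp.inv
    rwa [det_mul, Real.log_mul hX.det_pos.ne' hTp.inv.det_pos.ne', det_nonsing_inv,
      Ring.inverse_eq_inv', Real.log_inv, ← sub_eq_add_neg] at h
  have htr : a * (A * T⁻¹).trace + b * (B * T⁻¹).trace = Fintype.card n := by
    have : T * T⁻¹ = 1 := mul_nonsing_inv _ ((isUnit_iff_isUnit_det _).mp hTp.isUnit)
    have h2 := congrArg trace this
    rw [hT, Matrix.add_mul, trace_add, Matrix.smul_mul, Matrix.smul_mul, trace_smul, trace_smul,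
      trace_one] at h2
    simpa [hT] using h2
  have h1 := mul_le_mul_of_nonneg_left (key A hA) ha
  have h2 := mul_le_mul_of_nonneg_left (key B hB) hb
  have h3 : a * Real.log T.det + b * Real.log T.det = Real.log T.det := by
    rw [← add_mul, hab, one_mul]
  have h4 : a * (Fintype.card n : ℝ) + b * (Fintype.card n : ℝ) = Fintype.card n := by
    rw [← add_mul, hab, one_mul]
  linarith

theorem det_sub_vecMulVec {M : Matrix n n ℝ} (hM : M.PosDef) (μ : n → ℝ) :
    (M - vecMulVec μ μ).det = M.det * (1 - μ ⬝ᵥ (M⁻¹ *ᵥ μ)) := by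
  have hu : IsUnit M.det := (isUnit_iff_isUnit_det _).mp hM.isUnit
  have h := det_add_replicateCol_mul_replicateRow (ι := Unit) hu (-μ) μ
  have e : M + replicateCol Unit (-μ) * replicateRow Unit μ = M - vecMulVec μ μ := by
    ext i j; simp [Matrix.mul_apply, vecMulVec_apply, sub_eq_add_neg]
  rw [e] at h
  rw [h]
  congr 1
  rw [det_unique, dotProduct_mulVec]
  simp [Matrix.add_apply, Matrix.mul_apply, dotProduct, vecMul, sub_eq_add_neg]

theorem bordered_posSemidef_iff {M : Matrix n n ℝ} (hM : M.PosDef) (μ : n → ℝ) (t : ℝ) :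
    (fromBlocks M (replicateCol Unit μ) (replicateRow Unit μ)
      (of fun _ _ : Unit => t)).PosSemidef ↔ μ ⬝ᵥ (M⁻¹ *ᵥ μ) ≤ t := by
  have := hM.isUnit.invertible
  have h := PosDef.fromBlocks₁₁ (replicateCol Unit μ) (of fun _ _ : Unit => t) hM
  rw [conjTranspose_replicateCol, star_trivial] at h
  rw [h]
  have e : (of fun _ _ : Unit => t) - replicateRow Unit μ * M⁻¹ * replicateCol Unit μ
      = diagonal fun _ : Unit => t - μ ⬝ᵥ (M⁻¹ *ᵥ μ) := by
    ext i j
    rw [dotProduct_mulVec]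
    simp [Matrix.mul_apply, dotProduct, vecMul]
  rw [e, posSemidef_diagonal_iff]
  simp

/-- The Schur complement of the bordered matrix `[C⁻¹ eᵢ; eᵢᵀ Cᵢᵢ]` shows `eᵢ eᵢᵀ ⪯ Cᵢᵢ C⁻¹`;
pair this with `A`. -/
theorem diag_le_mul_trace_mul_inv {A C : Matrix n n ℝ} (hA : A.PosSemidef) (hC : C.PosDef) (i : n) :
    A i i ≤ C i i * (A * C⁻¹).trace := by
  set e : n → ℝ := Pi.single i 1
  have hc : 0 < C i i := hC.diag_pos
  have hb := (bordered_posSemidef_iff hC.inv e (C i i)).mpr (by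
    rw [nonsing_inv_nonsing_inv _ ((isUnit_iff_isUnit_det _).mp hC.isUnit)]
    simp [e])
  have hP : (C i i • C⁻¹ - vecMulVec e e).PosSemidef := by
    refine PosSemidef.of_dotProduct_mulVec_nonneg
      ((hC.inv.posSemidef.smul hc.le).1.sub (posSemidef_vecMulVec e).1) fun x => ?_
    -- the last coordinate minimises the bordered quadratic form for fixed `x`
    have h := hb.dotProduct_mulVec_nonneg (Sum.elim x fun _ => -(e ⬝ᵥ x) / C i i)
    rw [star_trivial] at h ⊢
    rw [bordered_quadForm] at h
    rw [sub_mulVec, dotProduct_sub, dotProduct_vecMulVec_mulVec, smul_mulVec, dotProduct_smul,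
      smul_eq_mul]
    have h2 := mul_nonneg hc.le h
    field_simp at h2
    nlinarith
  have h := trace_mul_nonneg hA hP
  rw [Matrix.mul_sub, trace_sub, Matrix.mul_smul, trace_smul, trace_mul_comm A (vecMulVec e e),
    vecMulVec_mul, trace_vecMulVec] at h
  simpa [e] using h

end Matrices

/-! ### The divergence in terms of second moments -/

variable {d : ℕ}

/-- In terms of the second-moment matrix `M = S + μ μᵀ` the divergence is the left-hand side of the
log-determinant constraint at `t = μᵀ M⁻¹ μ`, because `det S = det M * (1 - μᵀ M⁻¹ μ)`. -/
theorem klDivergence_eq {S C : Mat d} (hS : S.PosDef) (hC : C.PosDef) (μ m : Vec d) :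
    klDivergence μ S m C = m ⬝ᵥ (C⁻¹ *ᵥ m) - 2 * (m ⬝ᵥ (C⁻¹ *ᵥ μ))
      + ((S + vecMulVec μ μ) * C⁻¹).trace - Real.log ((S + vecMulVec μ μ) * C⁻¹).det
      - Real.log (1 - μ ⬝ᵥ ((S + vecMulVec μ μ)⁻¹ *ᵥ μ)) - ((d : ℝ) + 1) := by
  set M := S + vecMulVec μ μ with hM
  have hMp : M.PosDef := hS.add_posSemidef (posSemidef_vecMulVec μ)
  have hSM : S = M - vecMulVec μ μ := by simp [hM]
  have hdet := det_sub_vecMulVec hMp μ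
  rw [← hSM] at hdet
  have hpos : 0 < 1 - μ ⬝ᵥ (M⁻¹ *ᵥ μ) := by
    have := hS.det_pos
    rw [hdet] at this
    exact (pos_iff_pos_of_mul_pos this).mp hMp.det_pos
  have hlog : Real.log (S * C⁻¹).det
      = Real.log (M * C⁻¹).det + Real.log (1 - μ ⬝ᵥ (M⁻¹ *ᵥ μ)) := by
    rw [← Real.log_mul (det_mul_pos hMp hC.inv).ne' hpos.ne', det_mul, det_mul, hdet]
    congr 1; ring
  have htr : (M * C⁻¹).trace = (S * C⁻¹).trace + μ ⬝ᵥ (C⁻¹ *ᵥ μ) := by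
    rw [hM, Matrix.add_mul, trace_add, trace_vecMulVec_mul]
  rw [klDivergence, hlog, htr]
  simp only [mulVec_sub, dotProduct_sub, sub_dotProduct, symm_dotProduct hC.inv.1 μ m]
  ring

theorem dotProduct_inv_mulVec_lt_one {S : Mat d} (hS : S.PosDef) (μ : Vec d) :
    μ ⬝ᵥ ((S + vecMulVec μ μ)⁻¹ *ᵥ μ) < 1 := by
  have hMp : (S + vecMulVec μ μ).PosDef := hS.add_posSemidef (posSemidef_vecMulVec μ)
  have h := hS.det_pos
  rw [← add_sub_cancel_right S (vecMulVec μ μ), det_sub_vecMulVec hMp μ] at h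
  linarith [(pos_iff_pos_of_mul_pos h).mp hMp.det_pos]

/-! ### Convexity of the feasible set -/

theorem logDetConstraint_convexCombo {m : Vec d} {C : Mat d} (hC : C.PosDef) {ρ : ℝ}
    {M M' : Mat d} (hM : M.PosDef) (hM' : M'.PosDef) {μ μ' : Vec d} {t t' : ℝ} (ht : t < 1)
    (ht' : t' < 1) (h : logDetConstraint m C ρ M μ t) (h' : logDetConstraint m C ρ M' μ' t')
    {a b : ℝ} (ha : 0 ≤ a) (hb : 0 ≤ b) (hab : a + b = 1) :
    logDetConstraint m C ρ (a • M + b • M') (a • μ + b • μ') (a * t + b * t') := by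
  have hlog : ∀ X : Mat d, X.PosDef →
      Real.log (X * C⁻¹).det = Real.log X.det + Real.log (C⁻¹).det := fun X hX => by
    rw [det_mul, Real.log_mul hX.det_pos.ne' hC.inv.det_pos.ne']
  unfold logDetConstraint at h h' ⊢
  rw [hlog _ hM] at h
  rw [hlog _ hM'] at h'
  rw [hlog _ (posDef_convexCombo hM hM' ha hb hab)]
  have h1 := log_det_concave hM hM' ha hb hab
  have h2 := strictConcaveOn_log_Ioi.concaveOn.2 (sub_pos.mpr ht) (sub_pos.mpr ht') ha hb hab
  have e : a • (1 - t) + b • (1 - t') = 1 - (a * t + b * t') := by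
    simp only [smul_eq_mul]; linear_combination hab
  rw [e] at h2
  simp only [smul_eq_mul] at h2
  rw [Matrix.add_mul, trace_add, Matrix.smul_mul, Matrix.smul_mul, trace_smul, trace_smul,
    mulVec_add, mulVec_smul, mulVec_smul, dotProduct_add, dotProduct_smul, dotProduct_smul]
  simp only [smul_eq_mul]
  have h3 := mul_le_mul_of_nonneg_left h ha
  have h4 := mul_le_mul_of_nonneg_left h' hb
  obtain rfl : b = 1 - a := by linarith
  linarith

theorem convex_sdpFeasible (μS : Vec d) {CS : Mat d} (hS : CS.PosDef) (μT : Vec d) {CT : Mat d}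
    (hT : CT.PosDef) (ρS ρT ε : ℝ) : Convex ℝ (sdpFeasible μS CS μT CT ρS ρT ε) := by
  rintro ⟨M, μ, t, τ⟩ ⟨h1, h2, h3, h4, h5, h6, h7, h8, h9⟩
    ⟨M', μ', t', τ'⟩ ⟨h1', h2', h3', h4', h5', h6', h7', h8', h9'⟩ a b ha hb hab
  refine ⟨add_nonneg (mul_nonneg ha h1) (mul_nonneg hb h1'), posDef_convexCombo h2 h2' ha hb hab,
    add_nonneg (mul_nonneg ha h3) (mul_nonneg hb h3'), ?_,
    logDetConstraint_convexCombo hS h2 h2' h4 h4' h5 h5' ha hb hab,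
    logDetConstraint_convexCombo hT h2 h2' h4 h4' h6 h6' ha hb hab, ?_, ?_, ?_⟩
  · exact convex_Iio (𝕜 := ℝ) (1 : ℝ) h4 h4' ha hb hab
  · convert posSemidef_convexCombo h7 h7' ha hb using 1
    ext (i | i) (j | j) <;> simp
  · convert posSemidef_convexCombo h8 h8' ha hb using 1
    ext (i | i) (j | j) <;> simp [toBlocks₁₁, toBlocks₁₂, toBlocks₂₂]
    ring
  · convert posSemidef_convexCombo h9 h9' ha hb using 1
    change a • M + b • M' - ε • (1 : Mat d) = _
    rw [smul_sub, smul_sub, sub_add_sub_comm, ← add_smul, hab, one_smul]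

/-! ### Compactness of the feasible set -/

/-- Exponentiated form of the log-determinant constraint, which is a closed condition also at the
boundary of the domain of the logarithms. -/
theorem logDetConstraint_iff {m : Vec d} {C : Mat d} (hC : C.PosDef) {ρ : ℝ} {M : Mat d}
    (hM : M.PosDef) {μ : Vec d} {t : ℝ} (ht : t < 1) :
    logDetConstraint m C ρ M μ t ↔
      Real.exp (m ⬝ᵥ (C⁻¹ *ᵥ m) - 2 * (m ⬝ᵥ (C⁻¹ *ᵥ μ)) + (M * C⁻¹).trace - ((d : ℝ) + 1) - ρ)
        ≤ (M * C⁻¹).det * (1 - t) := by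
  have h1 := det_mul_pos hM hC.inv
  have h2 := sub_pos.mpr ht
  rw [← Real.le_log_iff_exp_le (mul_pos h1 h2), Real.log_mul h1.ne' h2.ne', logDetConstraint]
  constructor <;> intro h <;> linarith

theorem posDef_of_sub_smul_one {ε : ℝ} (hε : 0 < ε) {M : Mat d}
    (h : (M - ε • (1 : Mat d)).PosSemidef) : M.PosDef := by
  simpa using ((PosDef.one (n := Idx d) (R := ℝ)).smul hε).add_posSemidef h

theorem isClosed_sdpFeasible (μS : Vec d) {CS : Mat d} (hS : CS.PosDef) (μT : Vec d) {CT : Mat d}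
    (hT : CT.PosDef) (ρS ρT : ℝ) {ε : ℝ} (hε : 0 < ε) :
    IsClosed (sdpFeasible μS CS μT CT ρS ρT ε) := by
  have e : sdpFeasible μS CS μT CT ρS ρT ε =
      {z : SDPVar d | 0 ≤ z.2.2.2} ∩ {z | 0 ≤ z.2.2.1} ∩
      {z | Real.exp (μS ⬝ᵥ (CS⁻¹ *ᵥ μS) - 2 * (μS ⬝ᵥ (CS⁻¹ *ᵥ z.2.1)) + (z.1 * CS⁻¹).trace
          - ((d : ℝ) + 1) - ρS) ≤ (z.1 * CS⁻¹).det * (1 - z.2.2.1)} ∩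
      {z | Real.exp (μT ⬝ᵥ (CT⁻¹ *ᵥ μT) - 2 * (μT ⬝ᵥ (CT⁻¹ *ᵥ z.2.1)) + (z.1 * CT⁻¹).trace
          - ((d : ℝ) + 1) - ρT) ≤ (z.1 * CT⁻¹).det * (1 - z.2.2.1)} ∩
      (fun z : SDPVar d => fromBlocks z.1 (replicateCol Unit z.2.1) (replicateRow Unit z.2.1)
        (of fun _ _ : Unit => z.2.2.1)) ⁻¹' {A | A.PosSemidef} ∩
      (fun z : SDPVar d => fromBlocks z.1.toBlocks₁₁ z.1.toBlocks₁₂ z.1.toBlocks₁₂ᵀ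
        (z.1.toBlocks₂₂ - of fun _ _ : Unit => z.2.2.2)) ⁻¹' {A | A.PosSemidef} ∩
      (fun z : SDPVar d => z.1 - ε • (1 : Mat d)) ⁻¹' {A | A.PosSemidef} := by
    ext ⟨M, μ, t, τ⟩
    constructor
    · rintro ⟨h1, h2, h3, h4, h5, h6, h7, h8, h9⟩
      exact ⟨⟨⟨⟨⟨⟨h1, h3⟩, (logDetConstraint_iff hS h2 h4).mp h5⟩,
        (logDetConstraint_iff hT h2 h4).mp h6⟩, h7⟩, h8⟩, h9⟩
    · rintro ⟨⟨⟨⟨⟨⟨h1, h3⟩, h5⟩, h6⟩, h7⟩, h8⟩, h9⟩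
      have h2 : M.PosDef := posDef_of_sub_smul_one hε h9
      -- the determinant and the exponential are positive, hence so is `1 - t`
      have h4 : t < 1 := sub_pos.mp <|
        (pos_iff_pos_of_mul_pos ((Real.exp_pos _).trans_le h5)).mp (det_mul_pos h2 hS.inv)
      exact ⟨h1, h2, h3, h4, (logDetConstraint_iff hS h2 h4).mpr h5,
        (logDetConstraint_iff hT h2 h4).mpr h6, h7, h8, h9⟩
  rw [e]
  refine (((((IsClosed.inter ?_ ?_).inter ?_).inter ?_).inter ?_).inter ?_).inter ?_
  · exact isClosed_le (by fun_prop) (by fun_prop)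
  · exact isClosed_le (by fun_prop) (by fun_prop)
  · exact isClosed_le (by fun_prop) (by fun_prop)
  · exact isClosed_le (by fun_prop) (by fun_prop)
  · refine isClosed_posSemidef.preimage (continuous_pi fun i => continuous_pi fun j => ?_)
    rcases i with i | i <;> rcases j with j | j <;> simp <;> fun_prop
  · refine isClosed_posSemidef.preimage (continuous_pi fun i => continuous_pi fun j => ?_)
    rcases i with i | i <;> rcases j with j | j <;>
      simp [toBlocks₁₁, toBlocks₁₂, toBlocks₂₂] <;> fun_prop
  · exact isClosed_posSemidef.preimage (by fun_prop)

/-- A feasible `M` has bounded trace against `C⁻¹`: the trace enters the constraint linearly with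
coefficient one, while `log det (M C⁻¹)` costs at most half of it (scale by `1/2` before applying
`log_det_mul_le`) and the cross term at most a quarter of it (since `μ μᵀ ⪯ M`), up to constants
depending on `m` and `C` only. -/
theorem trace_mul_inv_le {m : Vec d} {C : Mat d} (hC : C.PosDef) {ρ : ℝ} {M : Mat d}
    (hM : M.PosDef) {μ : Vec d} {t : ℝ} (ht0 : 0 ≤ t) (ht : t < 1)
    (hb : (fromBlocks M (replicateCol Unit μ) (replicateRow Unit μ)
        (of fun _ _ : Unit => t)).PosSemidef) (h : logDetConstraint m C ρ M μ t) :
    (M * C⁻¹).trace ≤ 4 * (ρ + 3 * (m ⬝ᵥ (C⁻¹ *ᵥ m)) + ((d : ℝ) + 1) * Real.log 2) := by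
  have hcard : (Fintype.card (Idx d) : ℝ) = (d : ℝ) + 1 := by simp
  have h1 : μ ⬝ᵥ (C⁻¹ *ᵥ μ) ≤ (M * C⁻¹).trace := by
    have := trace_mul_nonneg (posDef_sub_vecMulVec hM ht hb).posSemidef hC.inv.posSemidef
    rw [Matrix.sub_mul, trace_sub, trace_vecMulVec_mul] at this
    linarith
  have h2 : 0 ≤ 4 * (m ⬝ᵥ (C⁻¹ *ᵥ m)) - 2 * (m ⬝ᵥ (C⁻¹ *ᵥ μ)) + 1 / 4 * (μ ⬝ᵥ (C⁻¹ *ᵥ μ)) := by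
    -- expand `‖2 m - μ / 2‖² ≥ 0` in the norm of `C⁻¹`
    have := hC.inv.posSemidef.dotProduct_mulVec_nonneg ((2 : ℝ) • m - (1 / 2 : ℝ) • μ)
    simp only [star_trivial, mulVec_sub, mulVec_smul, dotProduct_sub, sub_dotProduct,
      dotProduct_smul, smul_dotProduct, smul_eq_mul, symm_dotProduct hC.inv.1 μ m] at this
    linarith
  have h3 : Real.log (M * C⁻¹).det
      ≤ (M * C⁻¹).trace / 2 - ((d : ℝ) + 1) + ((d : ℝ) + 1) * Real.log 2 := by
    have := log_det_mul_le (hM.smul (show (0 : ℝ) < 1 / 2 by norm_num)) hC.inv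
    rw [Matrix.smul_mul, trace_smul, det_smul, Real.log_mul (by positivity)
      (det_mul_pos hM hC.inv).ne', Real.log_pow, one_div, Real.log_inv, hcard, smul_eq_mul] at this
    linarith
  have h4 : Real.log (1 - t) ≤ 0 := Real.log_nonpos (by linarith) (by linarith)
  unfold logDetConstraint at h
  linarith

theorem isCompact_sdpFeasible (μS : Vec d) {CS : Mat d} (hS : CS.PosDef) (μT : Vec d) {CT : Mat d}
    (hT : CT.PosDef) (ρS ρT : ℝ) {ε : ℝ} (hε : 0 < ε) :
    IsCompact (sdpFeasible μS CS μT CT ρS ρT ε) := by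
  set K := 4 * (ρS + 3 * (μS ⬝ᵥ (CS⁻¹ *ᵥ μS)) + ((d : ℝ) + 1) * Real.log 2)
  set R := (∑ i, CS i i) * K + 1
  have hK : IsCompact ((Set.univ.pi fun _ => Set.univ.pi fun _ => Set.Icc (-R) R) ×ˢ
      (Set.univ.pi fun _ => Set.Icc (-R) R) ×ˢ Set.Icc 0 1 ×ˢ Set.Icc 0 R : Set (SDPVar d)) :=
    (isCompact_univ_pi fun _ => isCompact_univ_pi fun _ => isCompact_Icc).prod
      ((isCompact_univ_pi fun _ => isCompact_Icc).prod (isCompact_Icc.prod isCompact_Icc))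
  refine hK.of_isClosed_subset (isClosed_sdpFeasible μS hS μT hT ρS ρT hε)
    fun (z : SDPVar d) hz => ?_
  obtain ⟨M, μ, t, τ⟩ := z
  obtain ⟨h1, h2, h3, h4, h5, h6, h7, h8, h9⟩ := hz
  have htr : (M * CS⁻¹).trace ≤ K := trace_mul_inv_le hS h2 h3 h4 h7 h5
  have hK0 : 0 ≤ K := (trace_mul_nonneg h2.posSemidef hS.inv.posSemidef).trans htr
  have hdiag : ∀ i, M i i ≤ R - 1 := fun i => by
    have hi : CS i i ≤ ∑ i, CS i i :=
      Finset.single_le_sum (f := fun i => CS i i) (fun i _ => hS.diag_pos.le) (Finset.mem_univ i)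
    calc M i i ≤ CS i i * (M * CS⁻¹).trace := diag_le_mul_trace_mul_inv h2.posSemidef hS i
      _ ≤ CS i i * K := mul_le_mul_of_nonneg_left htr hS.diag_pos.le
      _ ≤ R - 1 := by simpa [R] using mul_le_mul_of_nonneg_right hi hK0
  have hpos : ∀ i, 0 < M i i := fun i => h2.diag_pos
  have hR : 1 ≤ R := by linarith [hdiag (Sum.inr ()), hpos (Sum.inr ())]
  have hsq : ∀ x : ℝ, x ^ 2 ≤ R ^ 2 → x ∈ Set.Icc (-R) R := fun x hx =>
    abs_le.mp (abs_le_of_sq_le_sq hx (by linarith))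
  refine ⟨fun i _ j _ => hsq _ ?_, fun i _ => hsq _ ?_, ⟨h3, h4.le⟩, h1, ?_⟩
  · have := sq_entry_le h2.posSemidef i j
    nlinarith [hdiag i, hdiag j, hpos i, hpos j]
  · have := sq_entry_le h7 (Sum.inl i) (Sum.inr ())
    simp at this
    nlinarith [hdiag i, hpos i]
  · have := h8.diag_nonneg (i := Sum.inr ())
    simp [toBlocks₂₂] at this
    linarith [hdiag (Sum.inr ())]

/-! ### The quadratic risk and its minimiser -/

/-- The expected square loss of `β` under any distribution with second-moment matrix `M`: the
quadratic form of `M` at `(β, -1)`. -/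
noncomputable def quadRisk (M : Mat d) (β : Fin d → ℝ) : ℝ :=
  joint β (-1) ⬝ᵥ (M *ᵥ joint β (-1))

theorem expertBlock_eq (M : Mat d) (τ : ℝ) :
    fromBlocks M.toBlocks₁₁ M.toBlocks₁₂ M.toBlocks₁₂ᵀ (M.toBlocks₂₂ - of fun _ _ : Unit => τ)
      = fromBlocks M.toBlocks₁₁ (replicateCol Unit fun i => M.toBlocks₁₂ i ())
        (replicateRow Unit fun i => M.toBlocks₁₂ i ())
        (of fun _ _ : Unit => M (Sum.inr ()) (Sum.inr ()) - τ) := by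
  ext (i | i) (j | j) <;> simp [toBlocks₁₂, toBlocks₂₂]

theorem quadRisk_eq {M : Mat d} (hM : M.IsHermitian) (β : Fin d → ℝ) :
    quadRisk M β = β ⬝ᵥ (M.toBlocks₁₁ *ᵥ β) - 2 * ((fun i => M.toBlocks₁₂ i ()) ⬝ᵥ β)
      + M (Sum.inr ()) (Sum.inr ()) := by
  have e : M = fromBlocks M.toBlocks₁₁ (replicateCol Unit fun i => M.toBlocks₁₂ i ())
        (replicateRow Unit fun i => M.toBlocks₁₂ i ())
        (of fun _ _ : Unit => M (Sum.inr ()) (Sum.inr ())) := by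
    ext (i | i) (j | j) <;> simp [toBlocks₁₁, toBlocks₁₂]
    simpa using hM.apply (Sum.inl j) (Sum.inr i)
  have h := bordered_quadForm M.toBlocks₁₁ (fun i => M.toBlocks₁₂ i ())
    (M (Sum.inr ()) (Sum.inr ())) β (-1)
  rw [← e] at h
  rw [quadRisk, joint, h]
  ring

theorem posDef_toBlocks₁₁ {M : Mat d} (hM : M.PosDef) : M.toBlocks₁₁.PosDef :=
  hM.submatrix Sum.inl_injective

theorem quadRisk_expert {M : Mat d} (hM : M.PosDef) :
    quadRisk M (expert M) = M (Sum.inr ()) (Sum.inr ())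
      - (fun i => M.toBlocks₁₂ i ()) ⬝ᵥ (M.toBlocks₁₁⁻¹ *ᵥ fun i => M.toBlocks₁₂ i ()) := by
  have hu := (isUnit_iff_isUnit_det _).mp (posDef_toBlocks₁₁ hM).isUnit
  rw [quadRisk_eq hM.1, expert, mulVec_mulVec, mul_nonsing_inv _ hu, one_mulVec, dotProduct_comm]
  ring

/-- The second block constraint of the program says that `τ` is at most the smallest value of
the quadratic risk, which `expert M` attains. -/
theorem expertBlock_posSemidef_iff {M : Mat d} (hM : M.PosDef) (τ : ℝ) :
    (fromBlocks M.toBlocks₁₁ M.toBlocks₁₂ M.toBlocks₁₂ᵀ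
      (M.toBlocks₂₂ - of fun _ _ : Unit => τ)).PosSemidef ↔ τ ≤ quadRisk M (expert M) := by
  rw [expertBlock_eq, bordered_posSemidef_iff (posDef_toBlocks₁₁ hM), quadRisk_expert hM]
  constructor <;> intro h <;> linarith

theorem quadRisk_expert_le {M : Mat d} (hM : M.PosDef) (β : Fin d → ℝ) :
    quadRisk M (expert M) ≤ quadRisk M β := by
  have h := ((expertBlock_posSemidef_iff hM _).mpr le_rfl).dotProduct_mulVec_nonneg
    (Sum.elim β fun _ => -1)
  rw [star_trivial, expertBlock_eq, bordered_quadForm] at h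
  rw [quadRisk_eq hM.1 β]
  linarith

theorem quadRisk_nonneg {M : Mat d} (hM : M.PosDef) (β : Fin d → ℝ) : 0 ≤ quadRisk M β := by
  simpa [quadRisk] using hM.posSemidef.dotProduct_mulVec_nonneg (joint β (-1))

/-! ### Feasible points of the program and the moment set -/

/-- The substitution `M = S + μ μᵀ`, `t = μᵀ M⁻¹ μ` embeds the moment set into the feasible set,
with `τ = 0`. -/
theorem sdpFeasible_of_mem_momentSet {μS μT : Vec d} {CS CT : Mat d} (hS : CS.PosDef)
    (hT : CT.PosDef) {ρS ρT ε : ℝ} {q : Vec d × Mat d} (hq : q ∈ momentSet μS CS μT CT ρS ρT ε) :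
    (q.2 + vecMulVec q.1 q.1, q.1, q.1 ⬝ᵥ ((q.2 + vecMulVec q.1 q.1)⁻¹ *ᵥ q.1), (0 : ℝ))
      ∈ sdpFeasible μS CS μT CT ρS ρT ε := by
  obtain ⟨μ, S⟩ := q
  obtain ⟨h1, h2, h3, h4⟩ := hq
  have hM : (S + vecMulVec μ μ).PosDef := h1.add_posSemidef (posSemidef_vecMulVec μ)
  rw [klDivergence_eq h1 hS] at h2
  rw [klDivergence_eq h1 hT] at h3
  refine ⟨le_rfl, hM, ?_, dotProduct_inv_mulVec_lt_one h1 μ, h2, h3,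
    (bordered_posSemidef_iff hM μ _).mpr le_rfl,
    (expertBlock_posSemidef_iff hM _).mpr (quadRisk_nonneg hM _), h4⟩
  simpa using hM.inv.posSemidef.dotProduct_mulVec_nonneg μ

/-- Conversely, the block constraint gives `t ≥ μᵀ M⁻¹ μ`, and lowering `t` to that value only
relaxes the log-determinant constraint. -/
theorem mem_momentSet_of_sdpFeasible {μS μT : Vec d} {CS CT : Mat d} (hS : CS.PosDef)
    (hT : CT.PosDef) {ρS ρT ε : ℝ} {M : Mat d} {μ : Vec d} {t τ : ℝ}
    (h : (M, μ, t, τ) ∈ sdpFeasible μS CS μT CT ρS ρT ε) :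
    (μ, M - vecMulVec μ μ) ∈ momentSet μS CS μT CT ρS ρT ε := by
  obtain ⟨-, h2, -, h4, h5, h6, h7, -, h9⟩ := h
  have hSp := posDef_sub_vecMulVec h2 h4 h7
  have hle : Real.log (1 - t) ≤ Real.log (1 - μ ⬝ᵥ (M⁻¹ *ᵥ μ)) :=
    Real.log_le_log (sub_pos.mpr h4) (sub_le_sub_left ((bordered_posSemidef_iff h2 μ t).mp h7) 1)
  refine ⟨hSp, ?_, ?_, by simpa using h9⟩
  · rw [klDivergence_eq hSp hS]
    unfold logDetConstraint at h5
    simp only [sub_add_cancel]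
    linarith
  · rw [klDivergence_eq hSp hT]
    unfold logDetConstraint at h6
    simp only [sub_add_cancel]
    linarith

/-- Replacing `τ` by its largest admissible value for the given `M` preserves feasibility. -/
theorem sdpFeasible_update_tau {μS μT : Vec d} {CS CT : Mat d} {ρS ρT ε : ℝ} {M : Mat d}
    {μ : Vec d} {t τ : ℝ} (h : (M, μ, t, τ) ∈ sdpFeasible μS CS μT CT ρS ρT ε) :
    (M, μ, t, quadRisk M (expert M)) ∈ sdpFeasible μS CS μT CT ρS ρT ε := by
  obtain ⟨-, h2, h3, h4, h5, h6, h7, -, h9⟩ := h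
  exact ⟨quadRisk_nonneg h2 _, h2, h3, h4, h5, h6, h7,
    (expertBlock_posSemidef_iff h2 _).mpr le_rfl, h9⟩

/-! ### The saddle point -/

theorem continuousAt_expert {M : Mat d} (hM : IsUnit M.toBlocks₁₁) :
    ContinuousAt (expert (d := d)) M := by
  have hinv : ContinuousAt (fun A : Mat d => A.toBlocks₁₁⁻¹) M := by
    have h11 : Continuous fun A : Mat d => A.toBlocks₁₁ := by
      unfold toBlocks₁₁; fun_prop
    simp only [inv_def, Ring.inverse_eq_inv']
    exact (h11.matrix_det.continuousAt.inv₀ ((isUnit_iff_isUnit_det _).mp hM).ne_zero).smul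
      h11.matrix_adjugate.continuousAt
  have h12 : Continuous fun A : Mat d => fun i => A.toBlocks₁₂ i () := by
    unfold toBlocks₁₂; fun_prop
  have hmul : Continuous fun p : Matrix (Fin d) (Fin d) ℝ × (Fin d → ℝ) => p.1 *ᵥ p.2 := by
    fun_prop
  exact hmul.continuousAt.comp (hinv.prodMk h12.continuousAt)

theorem continuous_quadRisk (M : Mat d) : Continuous (quadRisk M) := by
  have hj : Continuous fun β : Fin d → ℝ => joint β (-1) :=
    continuous_pi fun i => by rcases i with i | i <;> simp [joint] <;> fun_prop
  unfold quadRisk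
  fun_prop

theorem quadRisk_combo (a b : ℝ) (M M' : Mat d) (β : Fin d → ℝ) :
    quadRisk (a • M + b • M') β = a * quadRisk M β + b * quadRisk M' β := by
  simp [quadRisk, add_mulVec, smul_mulVec, dotProduct_add, dotProduct_smul]

open Filter Topology in
/-- The saddle-point inequality. For a feasible `M'` let `M_s = (1 - s) M + s M'` and
`β_s = expert M_s`. Optimality of `τ` gives `quadRisk M_s β_s ≤ τ`, while `quadRisk M β_s ≥ τ`;
hence `quadRisk M' β_s ≤ τ` for `0 < s ≤ 1`, and `β_s → expert M` as `s → 0`. -/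
theorem quadRisk_le_of_solvesSDP {μS μT : Vec d} {CS CT : Mat d} (hS : CS.PosDef)
    (hT : CT.PosDef) {ρS ρT ε : ℝ} {M : Mat d} {μ : Vec d} {t τ : ℝ}
    (h : SolvesSDP (sdpFeasible μS CS μT CT ρS ρT ε) (M, μ, t, τ)) {z : SDPVar d}
    (hz : z ∈ sdpFeasible μS CS μT CT ρS ρT ε) : quadRisk z.1 (expert M) ≤ τ := by
  obtain ⟨hF, hopt⟩ := h
  have hM : M.PosDef := hF.2.1
  have hτ : τ ≤ quadRisk M (expert M) :=
    (expertBlock_posSemidef_iff hM τ).mp hF.2.2.2.2.2.2.2.1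
  have hle : ∀ s ∈ Set.Ioc (0 : ℝ) 1, quadRisk z.1 (expert ((1 - s) • M + s • z.1)) ≤ τ := by
    rintro s ⟨hs0, hs1⟩
    have hc := convex_sdpFeasible μS hS μT hT ρS ρT ε hF hz (sub_nonneg.mpr hs1) hs0.le
      (sub_add_cancel 1 s)
    have h1 : quadRisk ((1 - s) • M + s • z.1) (expert ((1 - s) • M + s • z.1)) ≤ τ :=
      hopt _ (sdpFeasible_update_tau hc)
    rw [quadRisk_combo] at h1
    have h2 := hτ.trans (quadRisk_expert_le hM (expert ((1 - s) • M + s • z.1)))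
    have h3 := mul_le_mul_of_nonneg_left h2 (sub_nonneg.mpr hs1)
    exact le_of_mul_le_mul_left (by linarith) hs0
  have hcont : ContinuousAt (fun s : ℝ => quadRisk z.1 (expert ((1 - s) • M + s • z.1))) 0 := by
    have hl : Continuous fun s : ℝ => (1 - s) • M + s • z.1 := by fun_prop
    have hE : ContinuousAt (expert (d := d)) ((1 - (0 : ℝ)) • M + (0 : ℝ) • z.1) := by
      simpa using continuousAt_expert (posDef_toBlocks₁₁ hM).isUnit
    exact (continuous_quadRisk z.1).continuousAt.comp
      (hE.comp (f := fun s : ℝ => (1 - s) • M + s • z.1) hl.continuousAt)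
  have hlim : Tendsto (fun s : ℝ => quadRisk z.1 (expert ((1 - s) • M + s • z.1))) (𝓝[>] 0)
      (𝓝 (quadRisk z.1 (expert M))) := by
    have := hcont.tendsto.mono_left (nhdsWithin_le_nhds (s := Set.Ioi 0))
    simpa using this
  exact le_of_tendsto hlim (Filter.mem_of_superset (Ioc_mem_nhdsGT one_pos) hle)

/-! ### Distributions with prescribed moments -/

theorem lintegral_loss {Q : Measure (Vec d)} [IsProbabilityMeasure Q] {μ : Vec d} {S : Mat d}
    (h : HasMoments Q μ S) (β : Fin d → ℝ) :
    ∫⁻ ξ, ENNReal.ofReal (loss β ξ) ∂Q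
      = ENNReal.ofReal (quadRisk (S + vecMulVec μ μ) β) := by
  obtain ⟨hL, hm, hc⟩ := h
  set w : Vec d := joint β (-1)
  have hloss : ∀ ξ : Vec d, loss β ξ = ∑ i, ∑ j, w i * w j * (ξ i * ξ j) := by
    intro ξ
    have : loss β ξ = (∑ i, w i * ξ i) ^ 2 := by
      simp [loss, w, joint, dotProduct, sub_eq_add_neg]
    rw [this, sq, Finset.sum_mul_sum]
    exact Finset.sum_congr rfl fun i _ => Finset.sum_congr rfl fun j _ => by ring
  have hint : ∀ i j, Integrable (fun ξ : Vec d => ξ i * ξ j) Q := fun i j =>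
    (hL i).integrable_mul (hL j)
  have hval : ∀ i j, ∫ ξ : Vec d, ξ i * ξ j ∂Q = (S + vecMulVec μ μ) i j := fun i j => by
    have := covariance_eq_sub (hL i) (hL j)
    rw [hc i j] at this
    simp only [Pi.mul_apply, hm] at this
    rw [Matrix.add_apply, vecMulVec_apply, this]
    ring
  have hint' : ∀ i, Integrable (fun ξ : Vec d => ∑ j, w i * w j * (ξ i * ξ j)) Q := fun i =>
    integrable_finsetSum _ fun j _ => (hint i j).const_mul _
  rw [← ofReal_integral_eq_lintegral_ofReal]
  · congr 1
    simp_rw [hloss]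
    rw [integral_finsetSum _ fun i _ => hint' i]
    simp_rw [integral_finsetSum _ fun j _ => (hint _ j).const_mul _, integral_const_mul, hval]
    simp only [quadRisk, dotProduct, mulVec, Finset.mul_sum]
    exact Finset.sum_congr rfl fun i _ => Finset.sum_congr rfl fun j _ => by ring
  · rw [funext hloss]
    exact integrable_finsetSum _ fun i _ => hint' i
  · exact Filter.Eventually.of_forall fun ξ => sq_nonneg _

/-- Gaussian distributions realise all means and positive semidefinite covariance matrices. -/
theorem exists_hasMoments (μ : Vec d) {S : Mat d} (hS : S.PosSemidef) :
    ∃ Q : Measure (Vec d), IsProbabilityMeasure Q ∧ HasMoments Q μ S := by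
  set G := multivariateGaussian (WithLp.toLp 2 μ) S
  have hmeas : Measurable (WithLp.ofLp : EuclideanSpace ℝ (Idx d) → Vec d) := by fun_prop
  have heval : ∀ i, AEStronglyMeasurable (fun ξ : Vec d => ξ i) (G.map WithLp.ofLp) := fun i =>
    (measurable_pi_apply i).aestronglyMeasurable
  have hL : ∀ i, MemLp (fun x : EuclideanSpace ℝ (Idx d) => x i) 2 G := fun i =>
    IsGaussian.memLp_dual G (EuclideanSpace.proj i) 2 (by simp)
  refine ⟨G.map WithLp.ofLp, Measure.isProbabilityMeasure_map hmeas.aemeasurable,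
    fun i => ?_, fun i => ?_, fun i j => ?_⟩
  · rw [memLp_map_measure_iff (heval i) hmeas.aemeasurable]
    exact hL i
  · rw [integral_map hmeas.aemeasurable (heval i)]
    have := (EuclideanSpace.proj (𝕜 := ℝ) i).integral_comp_id_comm
      (IsGaussian.integrable_id (μ := G))
    simpa [G] using this
  · rw [covariance_map_fun (heval i) (heval j) hmeas.aemeasurable]
    exact covariance_eval_multivariateGaussian hS i j

theorem quadRisk_le_worstCaseRisk {U : Set (Vec d × Mat d)} {q : Vec d × Mat d} (hq : q ∈ U)
    (hp : q.2.PosSemidef) (β : Fin d → ℝ) :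
    ENNReal.ofReal (quadRisk (q.2 + vecMulVec q.1 q.1) β)
      ≤ worstCaseRisk (distributionSet U) β := by
  obtain ⟨Q, hQ, hQm⟩ := exists_hasMoments q.1 hp
  rw [← lintegral_loss hQm]
  exact le_iSup₂_of_le Q ⟨hQ, q, hq, hQm⟩ le_rfl

theorem solvesDRO_expert {μS μT : Vec d} {CS CT : Mat d} (hS : CS.PosDef) (hT : CT.PosDef)
    {ρS ρT ε : ℝ} {M : Mat d} {μ : Vec d} {t τ : ℝ}
    (h : SolvesSDP (sdpFeasible μS CS μT CT ρS ρT ε) (M, μ, t, τ)) :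
    SolvesDRO (distributionSet (momentSet μS CS μT CT ρS ρT ε)) (expert M) := by
  have hM : M.PosDef := h.1.2.1
  have hup : worstCaseRisk (distributionSet (momentSet μS CS μT CT ρS ρT ε)) (expert M)
      ≤ ENNReal.ofReal τ := by
    refine iSup₂_le fun Q hQ => ?_
    obtain ⟨hQp, q, hq, hQm⟩ := hQ
    rw [lintegral_loss hQm]
    exact ENNReal.ofReal_le_ofReal
      (quadRisk_le_of_solvesSDP hS hT h (sdpFeasible_of_mem_momentSet hS hT hq))
  refine ⟨(hup.trans_lt ENNReal.ofReal_lt_top).ne, fun β' => hup.trans ?_⟩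
  have hq := mem_momentSet_of_sdpFeasible hS hT h.1
  refine (ENNReal.ofReal_le_ofReal ?_).trans (quadRisk_le_worstCaseRisk hq hq.1.posSemidef β')
  rw [sub_add_cancel]
  exact ((expertBlock_posSemidef_iff hM τ).mp h.1.2.2.2.2.2.2.2.1).trans (quadRisk_expert_le hM β')

end SIKL

theorem mainTheorem1 (d NS NT : ℕ)
    (xS : Fin NS → Fin d → ℝ) (yS : Fin NS → ℝ)
    (xT : Fin NT → Fin d → ℝ) (yT : Fin NT → ℝ)
    (hS : (SIKL.empCov xS yS).PosDef) (hT : (SIKL.empCov xT yT).PosDef)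
    (ρS ρT ε : ℝ) (hε : 0 < ε)
    (hB : (SIKL.distributionSet (SIKL.momentSet (SIKL.empMean xS yS) (SIKL.empCov xS yS)
      (SIKL.empMean xT yT) (SIKL.empCov xT yT) ρS ρT ε)).Nonempty) :
    Convex ℝ (SIKL.sdpFeasible (SIKL.empMean xS yS) (SIKL.empCov xS yS)
      (SIKL.empMean xT yT) (SIKL.empCov xT yT) ρS ρT ε) ∧
    (∃ z : SIKL.SDPVar d, SIKL.SolvesSDP (SIKL.sdpFeasible (SIKL.empMean xS yS)
      (SIKL.empCov xS yS) (SIKL.empMean xT yT) (SIKL.empCov xT yT) ρS ρT ε) z) ∧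
    ∀ (M : SIKL.Mat d) (μ : SIKL.Vec d) (t τ : ℝ),
      SIKL.SolvesSDP (SIKL.sdpFeasible (SIKL.empMean xS yS) (SIKL.empCov xS yS)
        (SIKL.empMean xT yT) (SIKL.empCov xT yT) ρS ρT ε) (M, μ, t, τ) →
      IsUnit M.toBlocks₁₁ ∧
      SIKL.SolvesDRO (SIKL.distributionSet (SIKL.momentSet (SIKL.empMean xS yS)
        (SIKL.empCov xS yS) (SIKL.empMean xT yT) (SIKL.empCov xT yT) ρS ρT ε))
        (SIKL.expert M) := by
  refine ⟨SIKL.convex_sdpFeasible _ hS _ hT _ _ _, ?_, fun M μ t τ h =>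
    ⟨(SIKL.posDef_toBlocks₁₁ h.1.2.1).isUnit, SIKL.solvesDRO_expert hS hT h⟩⟩
  obtain ⟨-, -, q, hq, -⟩ := hB
  obtain ⟨z, hz, hmax⟩ := (SIKL.isCompact_sdpFeasible _ hS _ hT ρS ρT hε).exists_isMaxOn
    ⟨_, SIKL.sdpFeasible_of_mem_momentSet hS hT hq⟩
    (f := fun z : SIKL.SDPVar d => z.2.2.2) (by fun_prop)
  exact ⟨z, hz, fun z' hz' => hmax hz'⟩
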